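/- Let $q$ be a complex number with $0<|q|<1$, and write $(x;q)_n=\prod_{i=0}^{n-1}(1-q^i x)$, $(x;q)_\infty=\prod_{i\ge 0}(1-q^i x)$ and $(q)_\infty=(q;q)_\infty$. Let $$\psi(q)=\sum_{n\ge 1}\frac{q^{n^2}}{(q;q^2)_n},\qquad \nu(q)=\sum_{n\ge 0}\frac{q^{n(n+1)}}{(-q;q^2)_{n+1}}$$ be the third order mock theta functions. Then $$1+2\psi(q)=\frac{1}{(q)_\infty}\sum_{n=0}^{\infty}(-1)^n q^{2n^2+n}\,(1+q^{2n+1})\sum_{j=-n}^{n}q^{-j(j+1)/2},$$ $$\nu(-q)=\frac{1}{(q)_\infty}\sum_{n=0}^{\infty}(-1)^n q^{2n^2+2n}\sum_{j=-n}^{n}q^{-j(j+1)/2},$$ where all the infinite series and the infinite product converge absolutely, $(q)_\infty\ne 0$, and no denominator vanishes. -/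

import Mathlib

noncomputable section

/-- The finite `q`-Pochhammer symbol `(x; q)_n = ∏_{i=0}^{n-1} (1 - q^i x)`. -/
def qPoch (x q : ℂ) (n : ℕ) : ℂ := ∏ i ∈ Finset.range n, (1 - q ^ i * x)

/-- The infinite `q`-Pochhammer symbol `(x; q)_∞ = ∏_{i ≥ 0} (1 - q^i x)`. -/
def qPochInf (x q : ℂ) : ℂ := ∏' i : ℕ, (1 - q ^ i * x)

/-- The `n`-th Eulerian term `q^{n^2} / (q; q^2)_n` of `ψ(q)`. -/
def psiTerm (q : ℂ) (n : ℕ) : ℂ := q ^ (n ^ 2) / qPoch q (q ^ 2) n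

/-- The third order mock theta function `ψ(q) = ∑_{n ≥ 1} q^{n^2} / (q; q^2)_n`. -/
def mockPsi (q : ℂ) : ℂ := ∑' n : ℕ, psiTerm q (n + 1)

/-- The `n`-th Eulerian term `q^{n(n+1)} / (-q; q^2)_{n+1}` of `ν(q)`. -/
def nuTerm (q : ℂ) (n : ℕ) : ℂ := q ^ (n * (n + 1)) / qPoch (-q) (q ^ 2) (n + 1)

/-- The third order mock theta function `ν(q) = ∑_{n ≥ 0} q^{n(n+1)} / (-q; q^2)_{n+1}`. -/
def mockNu (q : ℂ) : ℂ := ∑' n : ℕ, nuTerm q n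

/-- The inner sum `∑_{j=-n}^{n} q^{-j(j+1)/2}`; the integer division is exact. -/
def innerSum (q : ℂ) (n : ℕ) : ℂ :=
  ∑ j ∈ Finset.Icc (-(n : ℤ)) (n : ℤ), q ^ (-(j * (j + 1) / 2))

end

/-!
The argument is Bailey's. Summing Bailey's transform against the finite form of Cauchy's identity
and letting `n → ∞` gives, for every Bailey pair relative to `(a, q)`,
`∑ a^n q^{n^2} β_n = (aq; q)_∞⁻¹ ∑ a^n q^{n^2} α_n`.

The unit pair relative to `(1, q)`, with `β = (1, 0, 0, …)`, has
`α_r = (-1)^r q^{r(r-1)/2} (1 + q^r)` for `r ≥ 1`. Passing from `a` to `aq` turns `α` into a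
weighted partial sum, here `(-1)^n q^{n^2+n} ∑_{j=-n}^{n} q^{-j(j+1)/2}`, while `β` solves a first
order recurrence whose solution is `(1 - q) / (q; q^2)_{n+1}`; this pair, relative to `(q, q)`,
gives `ν(-q)`. In the other direction, `α_n + α_{n-1}` is the `α`-sequence of a pair relative to
`(1, q)` with `β_0 = 1` and `β_n = 2 / (q; q^2)_n` for `n ≥ 1`, which gives `1 + 2 ψ(q)`.
-/

open Finset Filter Topology Asymptotics

section qPoch

variable {x q : ℂ}

theorem qPoch_zero (x q : ℂ) : qPoch x q 0 = 1 :=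
  prod_range_zero _

theorem qPoch_succ (x q : ℂ) (n : ℕ) : qPoch x q (n + 1) = qPoch x q n * (1 - q ^ n * x) :=
  prod_range_succ _ _

theorem qPoch_add (x q : ℂ) (m n : ℕ) :
    qPoch x q (m + n) = qPoch x q m * qPoch (x * q ^ m) q n := by
  simp only [qPoch, prod_range_add]
  congr! 3
  ring

theorem qPoch_succ' (x q : ℂ) (n : ℕ) : qPoch x q (n + 1) = (1 - x) * qPoch (x * q) q n := by
  rw [add_comm, qPoch_add, qPoch_succ, qPoch_zero, pow_zero, one_mul, one_mul, pow_one]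

theorem qPoch_mul_self_ne_zero (hx : ∀ n, qPoch x q n ≠ 0) (n : ℕ) : qPoch (x * q) q n ≠ 0 :=
  right_ne_zero_of_mul (qPoch_succ' x q n ▸ hx (n + 1))

theorem one_sub_pow_mul_ne_zero (hx : ∀ n, qPoch x q n ≠ 0) (n : ℕ) : 1 - q ^ n * x ≠ 0 :=
  right_ne_zero_of_mul (qPoch_succ x q n ▸ hx (n + 1))

theorem one_sub_pow_mul_mul_inv_qPoch_succ (hx : ∀ n, qPoch x q n ≠ 0) (n : ℕ) :
    (1 - q ^ n * x) * (qPoch x q (n + 1))⁻¹ = (qPoch x q n)⁻¹ := by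
  rw [qPoch_succ, mul_inv, mul_left_comm, mul_inv_cancel₀ (one_sub_pow_mul_ne_zero hx n), mul_one]

theorem one_sub_mul_inv_qPoch_succ (hx : ∀ n, qPoch x q n ≠ 0) (n : ℕ) :
    (1 - x) * (qPoch x q (n + 1))⁻¹ = (qPoch (x * q) q n)⁻¹ := by
  rw [qPoch_succ', mul_inv, mul_inv_cancel_left₀ (by simpa using one_sub_pow_mul_ne_zero hx 0)]

theorem one_sub_pow_mul_ne_zero_of_norm_lt_one (hq : ‖q‖ ≤ 1) (hx : ‖x‖ < 1) (n : ℕ) :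
    1 - q ^ n * x ≠ 0 := by
  refine sub_ne_zero.mpr fun h => (?_ : ‖q ^ n * x‖ < 1).ne (by rw [← h, norm_one])
  rw [norm_mul, norm_pow]
  exact (mul_le_of_le_one_left (norm_nonneg x) (pow_le_one₀ (norm_nonneg q) hq)).trans_lt hx

theorem qPoch_ne_zero_of_norm_lt_one (hq : ‖q‖ ≤ 1) (hx : ‖x‖ < 1) (n : ℕ) : qPoch x q n ≠ 0 :=
  prod_ne_zero_iff.mpr fun i _ => one_sub_pow_mul_ne_zero_of_norm_lt_one hq hx i

theorem summable_norm_neg_pow_mul (hq : ‖q‖ < 1) (x : ℂ) :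
    Summable fun i : ℕ => ‖-(q ^ i * x)‖ := by
  simpa only [norm_neg] using ((summable_geometric_of_norm_lt_one hq).mul_right x).norm

theorem multipliable_one_sub_pow_mul (hq : ‖q‖ < 1) (x : ℂ) :
    Multipliable fun i : ℕ => 1 - q ^ i * x := by
  simpa only [sub_eq_add_neg] using
    multipliable_one_add_of_summable (summable_norm_neg_pow_mul hq x)

theorem qPochInf_eq_one_sub_mul (hq : ‖q‖ < 1) (x : ℂ) :
    qPochInf x q = (1 - x) * qPochInf (x * q) q := by
  have h : ∀ i : ℕ, 1 - q ^ (i + 1) * x = 1 - q ^ i * (x * q) := fun i => by ring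
  rw [qPochInf, tprod_eq_zero_mul' (by simpa only [h] using multipliable_one_sub_pow_mul hq _)]
  simp only [h, pow_zero, one_mul, qPochInf]

theorem qPochInf_ne_zero (hq : ‖q‖ < 1) (hx : ∀ n, qPoch x q n ≠ 0) : qPochInf x q ≠ 0 := by
  simpa only [qPochInf, sub_eq_add_neg] using
    tprod_one_add_ne_zero_of_summable (f := fun i : ℕ => -(q ^ i * x))
      (fun i => by simpa only [sub_eq_add_neg] using one_sub_pow_mul_ne_zero hx i)
      (summable_norm_neg_pow_mul hq x)

theorem tendsto_inv_qPoch (hq : ‖q‖ < 1) (hx : ∀ n, qPoch x q n ≠ 0) :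
    Tendsto (fun n => (qPoch x q n)⁻¹) atTop (𝓝 (qPochInf x q)⁻¹) :=
  (multipliable_one_sub_pow_mul hq x).hasProd.tendsto_prod_nat.inv₀ (qPochInf_ne_zero hq hx)

theorem exists_norm_inv_qPoch_le (hq : ‖q‖ < 1) (hx : ∀ n, qPoch x q n ≠ 0) :
    ∃ C, ∀ n, ‖(qPoch x q n)⁻¹‖ ≤ C := by
  obtain ⟨C, hC⟩ := (Metric.isBounded_range_of_tendsto _ (tendsto_inv_qPoch hq hx)).exists_norm_le
  exact ⟨C, fun n => hC _ ⟨n, rfl⟩⟩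

end qPoch

section Series

theorem tendsto_sum_range_mul_of_bounded {R : Type*} [NormedRing R] [CompleteSpace R]
    {b : ℕ → R} {w : ℕ → ℕ → R} {L : R} {C : ℝ} (hb : Summable fun r => ‖b r‖)
    (hw : ∀ n r, r ≤ n → ‖w n r‖ ≤ C) (hlim : ∀ r, Tendsto (fun n => w n r) atTop (𝓝 L)) :
    Tendsto (fun n => ∑ r ∈ range (n + 1), b r * w n r) atTop (𝓝 ((∑' r, b r) * L)) := by
  have hsum (n : ℕ) : ∑ r ∈ range (n + 1), b r * w n r
      = ∑' r, if r ≤ n then b r * w n r else 0 := by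
    rw [tsum_eq_sum (s := range (n + 1)) fun r hr => if_neg (by simpa using hr)]
    exact sum_congr rfl fun r hr => (if_pos (mem_range_succ_iff.mp hr)).symm
  simp only [hsum, ← hb.of_norm.tsum_mul_right]
  refine tendsto_tsum_of_dominated_convergence (hb.mul_right C) (fun r => ?_)
    (.of_forall fun n r => ?_)
  · refine ((hlim r).const_mul (b r)).congr' ?_
    filter_upwards [eventually_ge_atTop r] with n hn using (if_pos hn).symm
  · split_ifs with h
    · exact (norm_mul_le _ _).trans (mul_le_mul_of_nonneg_left (hw n r h) (norm_nonneg _))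
    · rw [norm_zero]
      exact mul_nonneg (norm_nonneg _) ((norm_nonneg _).trans (hw r r le_rfl))

theorem summable_pow_mul_of_isBigO {𝕜 : Type*} [NormedField 𝕜] [CompleteSpace 𝕜] {q : 𝕜}
    (hq : ‖q‖ < 1) {c : ℕ → 𝕜} {k : ℕ}
    (hc : c =O[atTop] fun n => ((n ^ k : ℕ) : 𝕜)) {e : ℕ → ℕ} (he : ∀ n, n ≤ e n) :
    Summable fun n => q ^ e n * c n := by
  refine .of_norm_bounded (summable_norm_mul_geometric_of_norm_lt_one' hq hc) fun n => ?_
  rw [norm_mul, norm_mul, norm_pow, norm_pow, mul_comm]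
  gcongr ‖c n‖ * ?_
  exact pow_le_pow_of_le_one (norm_nonneg q) hq.le (he n)

end Series

section BaileyPair

variable {a q : ℂ} {α β : ℕ → ℂ}

/-- The sequence `0, f 0, f 1, …`, so that index `-1` causes no case distinctions. -/
def delay {M : Type*} [Zero M] (f : ℕ → M) : ℕ → M
  | 0 => 0
  | n + 1 => f n

theorem sum_range_delay_mul {R : Type*} [NonUnitalNonAssocSemiring R] (f g : ℕ → R) (n : ℕ) :
    ∑ r ∈ range (n + 1), delay f r * g r = ∑ r ∈ range n, f r * g (r + 1) := by
  simp [sum_range_succ', delay]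

theorem hasSum_mul_delay {R : Type*} [NonUnitalNonAssocRing R] [TopologicalSpace R]
    [IsTopologicalAddGroup R] {f g : ℕ → R} {s : R} (h : HasSum (fun n => g (n + 1) * f n) s) :
    HasSum (fun n => g n * delay f n) s := by
  rw [← hasSum_nat_add_iff' 1]
  simpa [delay] using h

/-- The kernel `1 / ((q; q)_{n-r} (aq; q)_{n+r})` of a Bailey pair, extended by `0` to `r > n`
in accordance with the convention `1 / (q; q)_{-k} = 0`. -/
noncomputable def baileyKernel (a q : ℂ) (n r : ℕ) : ℂ :=
  if r ≤ n then (qPoch q q (n - r))⁻¹ * (qPoch (a * q) q (n + r))⁻¹ else 0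

/-- `(α, β)` is a Bailey pair relative to `(a, q)`, that is,
`β n = ∑_{r ≤ n} α r / ((q; q)_{n-r} (aq; q)_{n+r})`. -/
def IsBaileyPair (a q : ℂ) (α β : ℕ → ℂ) : Prop :=
  ∀ n, β n = ∑ r ∈ range (n + 1), α r * baileyKernel a q n r

theorem baileyKernel_add_left (a q : ℂ) (r m : ℕ) :
    baileyKernel a q (r + m) r = (qPoch q q m)⁻¹ * (qPoch (a * q) q (2 * r + m))⁻¹ := by
  rw [baileyKernel, if_pos (Nat.le_add_right r m), Nat.add_sub_cancel_left,
    show r + m + r = 2 * r + m by ring]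

theorem baileyKernel_of_lt (a q : ℂ) {n r : ℕ} (h : n < r) : baileyKernel a q n r = 0 :=
  if_neg h.not_ge

theorem one_sub_mul_baileyKernel (ha : ∀ n, qPoch (a * q) q n ≠ 0) (r m : ℕ) :
    (1 - a * q) * baileyKernel a q (r + m) r =
      (1 - a * q ^ (2 * r + m + 1)) * baileyKernel (a * q) q (r + m) r := by
  rw [baileyKernel_add_left, baileyKernel_add_left]
  linear_combination (qPoch q q m)⁻¹ *
    ((1 - a * q ^ (2 * r + m + 1)) * one_sub_mul_inv_qPoch_succ ha (2 * r + m) -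
      (1 - a * q) * one_sub_pow_mul_mul_inv_qPoch_succ ha (2 * r + m))

theorem one_sub_pow_mul_baileyKernel (hq : ∀ n, qPoch q q n ≠ 0)
    (ha : ∀ n, qPoch (a * q) q n ≠ 0) (r m : ℕ) :
    (1 - q ^ m) * baileyKernel a q (r + m) r =
      (1 - a * q ^ (2 * r + m + 1)) * baileyKernel a q (r + m) (r + 1) := by
  rcases m with _ | m
  · simp [baileyKernel_of_lt]
  · rw [baileyKernel_add_left, show r + (m + 1) = r + 1 + m by ring, baileyKernel_add_left,
      show 2 * (r + 1) + m = 2 * r + (m + 1) + 1 by ring]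
    linear_combination
      (qPoch (a * q) q (2 * r + (m + 1)))⁻¹ * one_sub_pow_mul_mul_inv_qPoch_succ hq m -
        (qPoch q q m)⁻¹ * one_sub_pow_mul_mul_inv_qPoch_succ ha (2 * r + (m + 1))

theorem one_sub_mul_baileyKernel_succ_right (hq : ∀ n, qPoch q q n ≠ 0)
    (ha : ∀ n, qPoch (a * q) q n ≠ 0) (r m : ℕ) :
    (1 - a * q) * baileyKernel a q (r + m) (r + 1) =
      (1 - q ^ m) * baileyKernel (a * q) q (r + m) r := by
  have hne : 1 - q ^ (2 * r + m) * (a * q) ≠ 0 := one_sub_pow_mul_ne_zero ha (2 * r + m)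
  refine mul_left_cancel₀ hne ?_
  linear_combination (1 - q ^ m) * one_sub_mul_baileyKernel ha r m -
    (1 - a * q) * one_sub_pow_mul_baileyKernel hq ha r m

theorem delay_baileyKernel (hq : ∀ n, qPoch q q n ≠ 0) (ha : ∀ n, qPoch (a * q) q n ≠ 0)
    (r m : ℕ) :
    delay (baileyKernel a q · r) (r + m) =
      (1 - q ^ m) * (1 - a * q ^ (2 * r + m)) * baileyKernel a q (r + m) r := by
  rcases m with _ | m
  · rcases r with _ | r <;> simp [delay, baileyKernel_of_lt]
  · rw [← add_assoc, delay, baileyKernel_add_left, add_assoc, baileyKernel_add_left, ← add_assoc,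
      ← one_sub_pow_mul_mul_inv_qPoch_succ hq, ← one_sub_pow_mul_mul_inv_qPoch_succ ha]
    ring

theorem IsBaileyPair.delay_eq (h : IsBaileyPair a q α β) (n : ℕ) :
    delay β n = ∑ r ∈ range (n + 1), α r * delay (baileyKernel a q · r) n := by
  rcases n with _ | n
  · simp [delay]
  · simp [delay, h n, sum_range_succ _ (n + 1), baileyKernel_of_lt]

theorem delay_baileyKernel_add_eq (hq : ∀ n, qPoch q q n ≠ 0) (ha : ∀ n, qPoch (a * q) q n ≠ 0)
    {n r : ℕ} (hr : r ≤ n) :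
    delay (baileyKernel (a * q) q · r) n + (1 - a * q ^ (2 * n + 1)) * baileyKernel (a * q) q n r =
      (1 - a * q) * (baileyKernel a q n r + baileyKernel a q n (r + 1)) := by
  obtain ⟨m, rfl⟩ := Nat.exists_eq_add_of_le hr
  rw [delay_baileyKernel hq (qPoch_mul_self_ne_zero ha)]
  linear_combination
    -one_sub_mul_baileyKernel ha r m - one_sub_mul_baileyKernel_succ_right hq ha r m

theorem baileyKernel_sub_delay_eq (hq : ∀ n, qPoch q q n ≠ 0) (ha : ∀ n, qPoch (a * q) q n ≠ 0)
    {n r : ℕ} (hr : r ≤ n) :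
    q ^ r * ((1 - a * q ^ (2 * n + 1)) * baileyKernel (a * q) q n r -
        delay (baileyKernel (a * q) q · r) n) =
      (1 - a * q) * q ^ n *
        (baileyKernel a q n r + a * q ^ (2 * r + 1) * baileyKernel a q n (r + 1)) := by
  obtain ⟨m, rfl⟩ := Nat.exists_eq_add_of_le hr
  rw [delay_baileyKernel hq (qPoch_mul_self_ne_zero ha)]
  linear_combination -q ^ (r + m) * (one_sub_mul_baileyKernel ha r m +
    a * q ^ (2 * r + 1) * one_sub_mul_baileyKernel_succ_right hq ha r m)

theorem IsBaileyPair.lower (h : IsBaileyPair (a * q) q α β) (hq : ∀ n, qPoch q q n ≠ 0)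
    (ha : ∀ n, qPoch (a * q) q n ≠ 0) :
    IsBaileyPair a q (fun n => α n + delay α n)
      (fun n => (delay β n + (1 - a * q ^ (2 * n + 1)) * β n) / (1 - a * q)) := by
  intro n
  have ha0 : 1 - a * q ≠ 0 := by simpa using one_sub_pow_mul_ne_zero ha 0
  have hshift : ∑ r ∈ range (n + 1), delay α r * baileyKernel a q n r =
      ∑ r ∈ range (n + 1), α r * baileyKernel a q n (r + 1) := by
    rw [sum_range_delay_mul, sum_range_succ _ n, baileyKernel_of_lt a q n.lt_succ_self, mul_zero,
      add_zero]
  simp only [add_mul, sum_add_distrib, hshift]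
  rw [div_eq_iff ha0, h.delay_eq, h n, mul_sum, ← sum_add_distrib, ← sum_add_distrib, sum_mul]
  refine sum_congr rfl fun r hr => ?_
  linear_combination α r * delay_baileyKernel_add_eq hq ha (mem_range_succ_iff.mp hr)

/-- The `α`-sequence of the Bailey pair relative to `(aq, q)` that a Bailey pair relative to
`(a, q)` generates; see `IsBaileyPair.raise`. -/
noncomputable def raisedSeq (a q : ℂ) (α : ℕ → ℂ) (r : ℕ) : ℂ :=
  (-a) ^ r * q ^ (r ^ 2 + r) * ∑ j ∈ range (r + 1), α j / ((-a) ^ j * q ^ j ^ 2)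

theorem sum_raisedSeq_recurrence (h : IsBaileyPair a q α β) (ha0 : a ≠ 0) (hq0 : q ≠ 0)
    (hq : ∀ n, qPoch q q n ≠ 0) (ha : ∀ n, qPoch (a * q) q n ≠ 0) (n : ℕ) :
    ∑ r ∈ range (n + 1), raisedSeq a q α r *
        ((1 - a * q ^ (2 * n + 1)) * baileyKernel (a * q) q n r -
          delay (baileyKernel (a * q) q · r) n) =
      (1 - a * q) * q ^ n * β n := by
  let w (r : ℕ) : ℂ := (-a) ^ r * q ^ r ^ 2
  have hw (r : ℕ) : w r ≠ 0 :=
    mul_ne_zero (pow_ne_zero _ (neg_ne_zero.mpr ha0)) (pow_ne_zero _ hq0)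
  -- Summation by parts: `w` turns the right side of `baileyKernel_sub_delay_eq` into a difference.
  have habel : ∑ r ∈ range (n + 1), (∑ j ∈ range (r + 1), α j / w j) *
        (w r * baileyKernel a q n r - w (r + 1) * baileyKernel a q n (r + 1)) =
      ∑ r ∈ range (n + 1), w r * baileyKernel a q n r * (α r / w r) := by
    have hparts := sum_range_by_parts (fun r => w r * baileyKernel a q n r) (fun j => α j / w j)
      (n + 1 + 1)
    rw [sum_range_succ _ (n + 1), Nat.add_sub_cancel,
      baileyKernel_of_lt a q n.lt_succ_self] at hparts
    simp only [mul_zero, zero_mul, add_zero, zero_sub, smul_eq_mul, ← sum_neg_distrib] at hparts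
    rw [hparts]
    exact sum_congr rfl fun r _ => by ring
  calc
    _ = ∑ r ∈ range (n + 1), (1 - a * q) * q ^ n * ((∑ j ∈ range (r + 1), α j / w j) *
          (w r * baileyKernel a q n r - w (r + 1) * baileyKernel a q n (r + 1))) := by
      refine sum_congr rfl fun r hr => ?_
      have hk := baileyKernel_sub_delay_eq hq ha (mem_range_succ_iff.mp hr)
      rw [raisedSeq]
      linear_combination (w r * ∑ j ∈ range (r + 1), α j / w j) * hk
    _ = (1 - a * q) * q ^ n * ∑ r ∈ range (n + 1), α r * baileyKernel a q n r := by
      rw [← mul_sum, habel]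
      congr 1
      exact sum_congr rfl fun r _ => by rw [mul_right_comm, mul_div_cancel₀ _ (hw r)]
    _ = (1 - a * q) * q ^ n * β n := by rw [h n]

theorem IsBaileyPair.raise (h : IsBaileyPair a q α β) (ha0 : a ≠ 0) (hq0 : q ≠ 0)
    (hq : ∀ n, qPoch q q n ≠ 0) (ha : ∀ n, qPoch (a * q) q n ≠ 0) {β' : ℕ → ℂ}
    (hβ' : ∀ n, (1 - a * q ^ (2 * n + 1)) * β' n = delay β' n + (1 - a * q) * q ^ n * β n) :
    IsBaileyPair (a * q) q (raisedSeq a q α) β' := by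
  let L (n : ℕ) : ℂ := ∑ r ∈ range (n + 1), raisedSeq a q α r * baileyKernel (a * q) q n r
  have hpair : IsBaileyPair (a * q) q (raisedSeq a q α) L := fun _ => rfl
  have hL (n : ℕ) :
      (1 - a * q ^ (2 * n + 1)) * L n = delay L n + (1 - a * q) * q ^ n * β n := by
    rw [← sum_raisedSeq_recurrence h ha0 hq0 hq ha, hpair.delay_eq, mul_sum, ← sum_add_distrib]
    exact sum_congr rfl fun r _ => by ring
  have hne (n : ℕ) : 1 - a * q ^ (2 * n + 1) ≠ 0 := by
    simpa only [pow_succ, mul_left_comm] using one_sub_pow_mul_ne_zero ha (2 * n)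
  suffices ∀ n, β' n = L n from this
  intro n
  refine mul_left_cancel₀ (hne n) ?_
  induction n with
  | zero => rw [hβ', hL, delay, delay]
  | succ n ih => rw [hβ', hL, delay, delay, mul_left_cancel₀ (hne n) ih]

end BaileyPair

section Chain

variable {a z q : ℂ} {α β : ℕ → ℂ}

/-- The summand of the finite form `sum_antidiagonal_cauchyTerm` of Cauchy's identity
`∑ z^i q^{i^2} / ((q; q)_i (zq; q)_i) = 1 / (zq; q)_∞`. -/
noncomputable def cauchyTerm (z q : ℂ) (p : ℕ × ℕ) : ℂ :=
  z ^ p.1 * q ^ p.1 ^ 2 * (qPoch q q p.1)⁻¹ * (qPoch (z * q) q p.1)⁻¹ * (qPoch q q p.2)⁻¹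

theorem one_sub_pow_mul_sum_cauchyTerm (hq : ∀ n, qPoch q q n ≠ 0)
    (hz : ∀ n, qPoch (z * q) q n ≠ 0) (n : ℕ) :
    (1 - q ^ (n + 1)) * ∑ p ∈ antidiagonal (n + 1), cauchyTerm z q p =
      ∑ p ∈ antidiagonal n, cauchyTerm z q p +
        z * q ^ (n + 1) / (1 - z * q) * ∑ p ∈ antidiagonal n, cauchyTerm (z * q) q p := by
  have hz0 : 1 - z * q ≠ 0 := by simpa using one_sub_pow_mul_ne_zero hz 0
  have hsplit : (1 - q ^ (n + 1)) * ∑ p ∈ antidiagonal (n + 1), cauchyTerm z q p =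
      ∑ p ∈ antidiagonal (n + 1), (1 - q ^ p.2) * cauchyTerm z q p +
        ∑ p ∈ antidiagonal (n + 1), q ^ p.2 * (1 - q ^ p.1) * cauchyTerm z q p := by
    rw [mul_sum, ← sum_add_distrib]
    refine sum_congr rfl fun p hp => ?_
    rw [← mem_antidiagonal.mp hp]
    ring
  rw [hsplit, Nat.sum_antidiagonal_succ', Nat.sum_antidiagonal_succ, mul_sum]
  simp only [pow_zero, sub_self, mul_zero, zero_mul, zero_add]
  congr 1 <;> refine sum_congr rfl fun p hp => ?_
  · simp only [cauchyTerm, ← one_sub_pow_mul_mul_inv_qPoch_succ hq p.2]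
    ring
  · rw [← mem_antidiagonal.mp hp, div_mul_eq_mul_div, eq_div_iff hz0]
    simp only [cauchyTerm, ← one_sub_pow_mul_mul_inv_qPoch_succ hq p.1,
      ← one_sub_mul_inv_qPoch_succ hz p.1]
    ring

theorem sum_antidiagonal_cauchyTerm (hq : ∀ n, qPoch q q n ≠ 0)
    (hz : ∀ n, qPoch (z * q) q n ≠ 0) (n : ℕ) :
    ∑ p ∈ antidiagonal n, cauchyTerm z q p = (qPoch q q n)⁻¹ * (qPoch (z * q) q n)⁻¹ := by
  induction n generalizing z with
  | zero => simp [cauchyTerm, qPoch_zero]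
  | succ n ih =>
    have hz0 : 1 - z * q ≠ 0 := by simpa using one_sub_pow_mul_ne_zero hz 0
    have hn : 1 - q ^ n * q ≠ 0 := one_sub_pow_mul_ne_zero hq n
    refine mul_left_cancel₀ hn ?_
    rw [← pow_succ, one_sub_pow_mul_sum_cauchyTerm hq hz, ih hz, ih (qPoch_mul_self_ne_zero hz)]
    have hdiv : z * q ^ (n + 1) / (1 - z * q) * (qPoch (z * q * q) q n)⁻¹ =
        z * q ^ (n + 1) * (qPoch (z * q) q (n + 1))⁻¹ := by
      rw [← one_sub_mul_inv_qPoch_succ hz, ← mul_assoc, div_mul_cancel₀ _ hz0]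
    linear_combination (qPoch q q n)⁻¹ * (hdiv - one_sub_pow_mul_mul_inv_qPoch_succ hz n) -
      (qPoch (z * q) q (n + 1))⁻¹ * one_sub_pow_mul_mul_inv_qPoch_succ hq n

theorem sum_mul_baileyKernel (hq : ∀ n, qPoch q q n ≠ 0) (ha : ∀ n, qPoch (a * q) q n ≠ 0)
    {n r : ℕ} (hr : r ≤ n) :
    ∑ s ∈ range (n + 1), a ^ s * q ^ s ^ 2 * (qPoch q q (n - s))⁻¹ * baileyKernel a q s r =
      a ^ r * q ^ r ^ 2 * baileyKernel a q n r := by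
  obtain ⟨m, rfl⟩ := Nat.exists_eq_add_of_le hr
  have hz (k : ℕ) : qPoch (a * q) q (2 * r + k) =
      qPoch (a * q) q (2 * r) * qPoch (a * q ^ (2 * r) * q) q k := by
    rw [qPoch_add, mul_right_comm]
  have hz0 (k : ℕ) : qPoch (a * q ^ (2 * r) * q) q k ≠ 0 :=
    right_ne_zero_of_mul (hz k ▸ ha (2 * r + k))
  rw [add_assoc, sum_range_add, sum_eq_zero fun s hs => by
      rw [baileyKernel_of_lt a q (mem_range.mp hs), mul_zero], zero_add, baileyKernel_add_left,
    hz, mul_inv, mul_left_comm (qPoch q q m)⁻¹, ← sum_antidiagonal_cauchyTerm hq hz0,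
    Nat.sum_antidiagonal_eq_sum_range_succ_mk, mul_sum, mul_sum]
  refine sum_congr rfl fun k _ => ?_
  rw [baileyKernel_add_left, hz, mul_inv, Nat.add_sub_add_left, cauchyTerm]
  ring

theorem IsBaileyPair.chain (h : IsBaileyPair a q α β) (hq : ∀ n, qPoch q q n ≠ 0)
    (ha : ∀ n, qPoch (a * q) q n ≠ 0) :
    IsBaileyPair a q (fun n => a ^ n * q ^ n ^ 2 * α n)
      (fun n => ∑ s ∈ range (n + 1), a ^ s * q ^ s ^ 2 * β s * (qPoch q q (n - s))⁻¹) := by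
  intro n
  have hβ {s : ℕ} (hs : s ∈ range (n + 1)) :
      β s = ∑ r ∈ range (n + 1), α r * baileyKernel a q s r := by
    rw [h s]
    refine sum_subset (range_mono (mem_range.mp hs)) fun r _ hr => ?_
    rw [baileyKernel_of_lt a q (by simpa using hr), mul_zero]
  calc
    _ = ∑ s ∈ range (n + 1), ∑ r ∈ range (n + 1),
          α r * (a ^ s * q ^ s ^ 2 * (qPoch q q (n - s))⁻¹ * baileyKernel a q s r) := by
      refine sum_congr rfl fun s hs => ?_
      rw [hβ hs, mul_sum, sum_mul]
      exact sum_congr rfl fun r _ => by ring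
    _ = ∑ r ∈ range (n + 1), a ^ r * q ^ r ^ 2 * α r * baileyKernel a q n r := by
      rw [sum_comm]
      refine sum_congr rfl fun r hr => ?_
      rw [← mul_sum, sum_mul_baileyKernel hq ha (mem_range_succ_iff.mp hr)]
      ring

theorem IsBaileyPair.tendsto (h : IsBaileyPair a q α β) (hq : ‖q‖ < 1)
    (ha : ∀ n, qPoch (a * q) q n ≠ 0) (hα : Summable α) :
    Tendsto β atTop (𝓝 ((∑' r, α r) * ((qPochInf q q)⁻¹ * (qPochInf (a * q) q)⁻¹))) := by
  have hqn := qPoch_ne_zero_of_norm_lt_one hq.le hq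
  obtain ⟨C, hC⟩ := exists_norm_inv_qPoch_le hq hqn
  obtain ⟨D, hD⟩ := exists_norm_inv_qPoch_le hq ha
  rw [funext h]
  refine tendsto_sum_range_mul_of_bounded hα.norm (C := C * D) (fun n r hr => ?_) fun r => ?_
  · rw [baileyKernel, if_pos hr, norm_mul]
    exact mul_le_mul (hC _) (hD _) (norm_nonneg _) ((norm_nonneg _).trans (hC 0))
  · refine (((tendsto_inv_qPoch hq hqn).comp (tendsto_sub_atTop_nat r)).mul
      ((tendsto_inv_qPoch hq ha).comp (tendsto_add_atTop_nat r))).congr' ?_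
    filter_upwards [eventually_ge_atTop r] with n hn using (if_pos hn).symm

theorem IsBaileyPair.tsum_eq (h : IsBaileyPair a q α β) (hq : ‖q‖ < 1)
    (ha : ∀ n, qPoch (a * q) q n ≠ 0) (hα : Summable fun n => a ^ n * q ^ n ^ 2 * α n)
    (hβ : Summable fun n => a ^ n * q ^ n ^ 2 * β n) :
    ∑' n, a ^ n * q ^ n ^ 2 * β n =
      (qPochInf (a * q) q)⁻¹ * ∑' n, a ^ n * q ^ n ^ 2 * α n := by
  have hqn := qPoch_ne_zero_of_norm_lt_one hq.le hq
  obtain ⟨C, hC⟩ := exists_norm_inv_qPoch_le hq hqn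
  have hlim : Tendsto
      (fun n => ∑ s ∈ range (n + 1), a ^ s * q ^ s ^ 2 * β s * (qPoch q q (n - s))⁻¹) atTop
      (𝓝 ((∑' n, a ^ n * q ^ n ^ 2 * β n) * (qPochInf q q)⁻¹)) :=
    tendsto_sum_range_mul_of_bounded hβ.norm (fun n r _ => hC (n - r)) fun r =>
      (tendsto_inv_qPoch hq hqn).comp (tendsto_sub_atTop_nat r)
  have heq := tendsto_nhds_unique hlim ((h.chain hqn ha).tendsto hq ha hα)
  refine mul_right_cancel₀ (inv_ne_zero (qPochInf_ne_zero hq hqn)) (heq.trans ?_)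
  ring

end Chain

section HeckePair

variable {q : ℂ}

/-- The `α`-sequence of the unit Bailey pair relative to `(1, q)`, whose `β`-sequence is
`1, 0, 0, …`. The exponent `r(r-1)/2` is written as `r.choose 2`. -/
noncomputable def unitAlpha (q : ℂ) : ℕ → ℂ
  | 0 => 1
  | r + 1 => (-1) ^ (r + 1) * q ^ (r + 1).choose 2 * (1 + q ^ (r + 1))

theorem choose_two_succ (n : ℕ) : (n + 1).choose 2 = n.choose 2 + n := by
  rw [Nat.choose_succ_succ', Nat.choose_one_right, add_comm]

theorem choose_two_add_choose_two_succ (n : ℕ) : n.choose 2 + (n + 1).choose 2 = n ^ 2 := by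
  induction n with
  | zero => rfl
  | succ n ih =>
    rw [choose_two_succ] at ih
    rw [choose_two_succ (n + 1), choose_two_succ n]
    linarith

theorem one_sub_pow_mul_sum_unitAlpha (hq : ∀ n, qPoch q q n ≠ 0) (r m : ℕ) :
    (1 - q ^ (r + m)) * ∑ j ∈ range (r + 1), unitAlpha q j * baileyKernel 1 q (r + m) j =
      (-1) ^ r * q ^ (r + 1).choose 2 * (1 - q ^ m) * baileyKernel 1 q (r + m) r := by
  induction r generalizing m with
  | zero => simp [unitAlpha]
  | succ r ih =>
    have hk := one_sub_pow_mul_baileyKernel (a := 1) hq (by simpa only [one_mul] using hq) r (m + 1)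
    have hr := ih (m + 1)
    rw [← add_assoc, add_right_comm] at hk hr
    rw [sum_range_succ, mul_add, hr, unitAlpha, choose_two_succ (r + 1)]
    linear_combination (-1) ^ r * q ^ (r + 1).choose 2 * hk

theorem isBaileyPair_unit (hq : ∀ n, qPoch q q n ≠ 0) :
    IsBaileyPair 1 q (unitAlpha q) (fun n => if n = 0 then 1 else 0) := by
  rintro (_ | n)
  · simp [unitAlpha, baileyKernel, qPoch_zero]
  · have h := one_sub_pow_mul_sum_unitAlpha hq (n + 1) 0
    have hn : 1 - q ^ n * q ≠ 0 := one_sub_pow_mul_ne_zero hq n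
    rw [add_zero, pow_zero, sub_self, mul_zero, zero_mul, pow_succ] at h
    exact (if_neg n.succ_ne_zero).trans ((mul_eq_zero_iff_left hn).mp h).symm

theorem innerSum_zero (q : ℂ) : innerSum q 0 = 1 := by
  simp [innerSum]

theorem zpow_neg_mul_succ_div_two {K : Type*} [DivisionRing K] (q : K) (n : ℕ) :
    q ^ (-((n : ℤ) * (n + 1) / 2)) = (q ^ (n + 1).choose 2)⁻¹ := by
  rw [zpow_neg, Nat.choose_two_right, Nat.add_sub_cancel, ← zpow_natCast, mul_comm]
  push_cast
  rfl

theorem innerSum_succ (q : ℂ) (n : ℕ) :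
    innerSum q (n + 1) =
      innerSum q n + ((q ^ (n + 1).choose 2)⁻¹ + (q ^ (n + 2).choose 2)⁻¹) := by
  have hneg : (-((n : ℤ) + 1)) * (-(n + 1) + 1) = n * (n + 1) := by ring
  rw [innerSum, Nat.cast_add_one, sum_Icc_succ_eq_add_endpoints, hneg, ← Nat.cast_add_one,
    zpow_neg_mul_succ_div_two, Nat.cast_add_one, zpow_neg_mul_succ_div_two, innerSum]
  ring

/-- The `α`-sequence `(-1)^n q^{n^2+n} ∑_{j=-n}^{n} q^{-j(j+1)/2}` of the Bailey pair relative to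
`(q, q)` whose `β`-sequence is `(1 - q) / (q; q^2)_{n+1}`. -/
noncomputable def heckeCoeff (q : ℂ) (n : ℕ) : ℂ :=
  (-1) ^ n * q ^ (n ^ 2 + n) * innerSum q n

theorem sum_unitAlpha_div (hq0 : q ≠ 0) (n : ℕ) :
    ∑ j ∈ range (n + 1), unitAlpha q j / ((-1) ^ j * q ^ j ^ 2) = innerSum q n := by
  induction n with
  | zero => simp [unitAlpha, innerSum_zero]
  | succ n ih =>
    rw [sum_range_succ, ih, innerSum_succ, unitAlpha, ← choose_two_add_choose_two_succ (n + 1),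
      choose_two_succ (n + 1)]
    have hsign : (-1 : ℂ) ^ (n + 1) ≠ 0 := pow_ne_zero _ (neg_ne_zero.mpr one_ne_zero)
    field_simp
    ring

theorem raisedSeq_unitAlpha (hq0 : q ≠ 0) : raisedSeq 1 q (unitAlpha q) = heckeCoeff q := by
  funext n
  rw [raisedSeq, sum_unitAlpha_div hq0, heckeCoeff]

theorem odd_qPoch_recurrence (hodd : ∀ n, qPoch q (q ^ 2) n ≠ 0) (n : ℕ) :
    (1 - q ^ (2 * n + 1)) * ((1 - q) * (qPoch q (q ^ 2) (n + 1))⁻¹) =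
      (1 - q) * (qPoch q (q ^ 2) n)⁻¹ := by
  linear_combination (1 - q) * one_sub_pow_mul_mul_inv_qPoch_succ hodd n

theorem isBaileyPair_heckeCoeff (hq0 : q ≠ 0) (hq : ∀ n, qPoch q q n ≠ 0)
    (hodd : ∀ n, qPoch q (q ^ 2) n ≠ 0) :
    IsBaileyPair q q (heckeCoeff q) (fun n => (1 - q) * (qPoch q (q ^ 2) (n + 1))⁻¹) := by
  have h := (isBaileyPair_unit hq).raise (β' := fun n => (1 - q) * (qPoch q (q ^ 2) (n + 1))⁻¹)
    one_ne_zero hq0 hq (by simpa only [one_mul] using hq) fun n => ?_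
  · rwa [one_mul, raisedSeq_unitAlpha hq0] at h
  · rw [one_mul, odd_qPoch_recurrence hodd]
    rcases n with _ | n <;> simp [delay, qPoch_zero]

theorem isBaileyPair_heckeCoeff_add_delay (hq0 : q ≠ 0) (hq : ∀ n, qPoch q q n ≠ 0)
    (hodd : ∀ n, qPoch q (q ^ 2) n ≠ 0) :
    IsBaileyPair 1 q (fun n => heckeCoeff q n + delay (heckeCoeff q) n)
      (fun n => (if n = 0 then 1 else 2) * (qPoch q (q ^ 2) n)⁻¹) := by
  have hpair : IsBaileyPair (1 * q) q (heckeCoeff q)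
      (fun n => (1 - q) * (qPoch q (q ^ 2) (n + 1))⁻¹) := by
    simpa only [one_mul] using isBaileyPair_heckeCoeff hq0 hq hodd
  convert hpair.lower hq (by simpa only [one_mul] using hq) using 2 with n
  have h1 : 1 - q ≠ 0 := by simpa using one_sub_pow_mul_ne_zero hq 0
  rw [one_mul, one_mul, odd_qPoch_recurrence hodd, eq_div_iff h1]
  rcases n with _ | n
  · simp [delay, qPoch_zero]
  · rw [if_neg n.succ_ne_zero, delay]
    ring

end HeckePair

section MockTheta

variable {q : ℂ}

theorem norm_heckeCoeff_le (hq0 : q ≠ 0) (hq : ‖q‖ ≤ 1) (n : ℕ) :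
    ‖heckeCoeff q n‖ ≤ 2 * n + 1 := by
  have hterm (j : ℤ) (hj : j ∈ Icc (-(n : ℤ)) n) :
      ‖q ^ (n ^ 2 + n) * q ^ (-(j * (j + 1) / 2))‖ ≤ 1 := by
    obtain ⟨hj₁, hj₂⟩ := mem_Icc.mp hj
    have hle : j * (j + 1) / 2 ≤ (n : ℤ) ^ 2 + n :=
      Int.ediv_le_of_le_mul two_pos (by nlinarith)
    have hexp : 0 ≤ ((n ^ 2 + n : ℕ) : ℤ) + -(j * (j + 1) / 2) := by
      push_cast
      linarith
    obtain ⟨e, he⟩ := Int.eq_ofNat_of_zero_le hexp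
    rw [← zpow_natCast, ← zpow_add₀ hq0, he, zpow_natCast, norm_pow]
    exact pow_le_one₀ (norm_nonneg q) hq
  calc ‖heckeCoeff q n‖ = ‖∑ j ∈ Icc (-(n : ℤ)) n, q ^ (n ^ 2 + n) * q ^ (-(j * (j + 1) / 2))‖ := by
        rw [heckeCoeff, innerSum, mul_assoc, norm_mul, norm_pow, norm_neg, norm_one, one_pow,
          one_mul, mul_sum]
    _ ≤ ∑ j ∈ Icc (-(n : ℤ)) n, 1 := norm_sum_le_of_le _ hterm
    _ = 2 * n + 1 := by
        rw [sum_const, Int.card_Icc, show ((n : ℤ) + 1 - -(n : ℤ)).toNat = 2 * n + 1 by omega]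
        simp

theorem isBigO_heckeCoeff (hq0 : q ≠ 0) (hq : ‖q‖ ≤ 1) :
    heckeCoeff q =O[atTop] fun n => ((n ^ 1 : ℕ) : ℂ) := by
  refine .of_bound 3 ?_
  filter_upwards [eventually_ge_atTop 1] with n hn
  have hn' : (1 : ℝ) ≤ n := Nat.one_le_cast.mpr hn
  rw [pow_one, Complex.norm_natCast]
  linarith [norm_heckeCoeff_le hq0 hq n]

theorem summable_pow_mul_heckeCoeff (hq0 : q ≠ 0) (hq1 : ‖q‖ < 1) {e : ℕ → ℕ}
    (he : ∀ n, n ≤ e n) : Summable fun n => q ^ e n * heckeCoeff q n :=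
  summable_pow_mul_of_isBigO hq1 (isBigO_heckeCoeff hq0 hq1.le) he

theorem odd_qPoch_ne_zero (hq : ‖q‖ < 1) (n : ℕ) : qPoch q (q ^ 2) n ≠ 0 :=
  qPoch_ne_zero_of_norm_lt_one (by rw [norm_pow]; exact pow_le_one₀ (norm_nonneg q) hq.le) hq n

theorem summable_pow_mul_inv_odd_qPoch (hq : ‖q‖ < 1) (k : ℕ) {e : ℕ → ℕ} (he : ∀ n, n ≤ e n) :
    Summable fun n => q ^ e n * (qPoch q (q ^ 2) (n + k))⁻¹ := by
  have hq2 : ‖q ^ 2‖ < 1 := by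
    rw [norm_pow]
    exact pow_lt_one₀ (norm_nonneg q) hq two_ne_zero
  have hlim := (tendsto_inv_qPoch hq2 (odd_qPoch_ne_zero hq)).comp (tendsto_add_atTop_nat k)
  refine summable_pow_mul_of_isBigO hq (k := 0) ?_ he
  simpa only [pow_zero, Nat.cast_one, Function.comp_def] using hlim.isBigO_one ℂ

theorem summable_psiTerm_succ (hq : ‖q‖ < 1) : Summable fun n => psiTerm q (n + 1) :=
  summable_pow_mul_inv_odd_qPoch hq 1 fun n => n.le_succ.trans (Nat.le_self_pow two_ne_zero _)

theorem nuTerm_neg (q : ℂ) (n : ℕ) :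
    nuTerm (-q) n = q ^ (n + n ^ 2) * (qPoch q (q ^ 2) (n + 1))⁻¹ := by
  rw [nuTerm, (Nat.even_mul_succ_self n).neg_pow, neg_neg, neg_sq, div_eq_mul_inv]
  ring

theorem summable_nuTerm_neg (hq : ‖q‖ < 1) : Summable (nuTerm (-q)) := by
  rw [funext (nuTerm_neg q)]
  exact summable_pow_mul_inv_odd_qPoch hq 1 fun n => Nat.le_add_right _ _

theorem hecke_nu_term_eq (q : ℂ) (n : ℕ) :
    (-1) ^ n * q ^ (2 * n ^ 2 + 2 * n) * innerSum q n = q ^ (n + n ^ 2) * heckeCoeff q n := by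
  rw [heckeCoeff]
  ring

theorem hecke_psi_term_eq (q : ℂ) (n : ℕ) :
    (-1) ^ n * q ^ (2 * n ^ 2 + n) * (1 + q ^ (2 * n + 1)) * innerSum q n =
      q ^ n ^ 2 * heckeCoeff q n + q ^ (n + 1) ^ 2 * heckeCoeff q n := by
  rw [heckeCoeff]
  ring

theorem summable_hecke_nu (hq0 : q ≠ 0) (hq1 : ‖q‖ < 1) :
    Summable fun n : ℕ => (-1) ^ n * q ^ (2 * n ^ 2 + 2 * n) * innerSum q n := by
  simp only [hecke_nu_term_eq]
  exact summable_pow_mul_heckeCoeff hq0 hq1 fun n => Nat.le_add_right _ _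

theorem summable_hecke_psi (hq0 : q ≠ 0) (hq1 : ‖q‖ < 1) :
    Summable fun n : ℕ =>
      (-1) ^ n * q ^ (2 * n ^ 2 + n) * (1 + q ^ (2 * n + 1)) * innerSum q n := by
  simp only [hecke_psi_term_eq]
  exact (summable_pow_mul_heckeCoeff hq0 hq1 fun n => Nat.le_self_pow two_ne_zero n).add
    (summable_pow_mul_heckeCoeff hq0 hq1 fun n => n.le_succ.trans (Nat.le_self_pow two_ne_zero _))

theorem hasSum_pow_mul_heckeCoeff_add_delay (hq0 : q ≠ 0) (hq1 : ‖q‖ < 1) :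
    HasSum (fun n => q ^ n ^ 2 * (heckeCoeff q n + delay (heckeCoeff q) n))
      (∑' n : ℕ, (-1) ^ n * q ^ (2 * n ^ 2 + n) * (1 + q ^ (2 * n + 1)) * innerSum q n) := by
  have hsum := summable_pow_mul_heckeCoeff hq0 hq1 fun n => Nat.le_self_pow two_ne_zero n
  have hsum_succ := summable_pow_mul_heckeCoeff hq0 hq1 (e := fun n => (n + 1) ^ 2)
    fun n => n.le_succ.trans (Nat.le_self_pow two_ne_zero _)
  simp only [hecke_psi_term_eq]
  rw [hsum.tsum_add hsum_succ]
  simp only [mul_add]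
  exact hsum.hasSum.add (hasSum_mul_delay (g := fun n => q ^ n ^ 2) hsum_succ.hasSum)

theorem hasSum_one_add_two_mul_mockPsi (hq : ‖q‖ < 1) :
    HasSum (fun n => q ^ n ^ 2 * ((if n = 0 then 1 else 2) * (qPoch q (q ^ 2) n)⁻¹))
      (1 + 2 * mockPsi q) := by
  have hsucc (n : ℕ) :
      q ^ (n + 1) ^ 2 * ((if n + 1 = 0 then 1 else 2) * (qPoch q (q ^ 2) (n + 1))⁻¹) =
        2 * psiTerm q (n + 1) := by
    rw [if_neg n.succ_ne_zero, psiTerm, mul_left_comm, div_eq_mul_inv]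
  rw [← hasSum_nat_add_iff' 1]
  simp only [hsucc]
  simpa [mockPsi, qPoch_zero] using (summable_psiTerm_succ hq).hasSum.mul_left 2

theorem mockNu_neg_eq (hq0 : q ≠ 0) (hq1 : ‖q‖ < 1) :
    mockNu (-q) =
      1 / qPochInf q q * ∑' n : ℕ, (-1) ^ n * q ^ (2 * n ^ 2 + 2 * n) * innerSum q n := by
  have hqn := qPoch_ne_zero_of_norm_lt_one hq1.le hq1
  have h1 : 1 - q ≠ 0 := by simpa using one_sub_pow_mul_ne_zero hqn 0
  have hmain := (isBaileyPair_heckeCoeff hq0 hqn (odd_qPoch_ne_zero hq1)).tsum_eq hq1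
    (qPoch_mul_self_ne_zero hqn)
    (by simpa only [← pow_add, ← hecke_nu_term_eq] using summable_hecke_nu hq0 hq1)
    (by simpa only [← pow_add, nuTerm_neg, mul_left_comm (1 - q)] using
      (summable_nuTerm_neg hq1).mul_left (1 - q))
  simp only [← pow_add, ← hecke_nu_term_eq, mul_left_comm _ (1 - q), ← nuTerm_neg, tsum_mul_left]
    at hmain
  rw [qPochInf_eq_one_sub_mul hq1 q, mockNu, one_div, mul_inv, mul_assoc, ← hmain,
    inv_mul_cancel_left₀ h1]

theorem one_add_two_mul_mockPsi_eq (hq0 : q ≠ 0) (hq1 : ‖q‖ < 1) :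
    1 + 2 * mockPsi q =
      1 / qPochInf q q *
        ∑' n : ℕ, (-1) ^ n * q ^ (2 * n ^ 2 + n) * (1 + q ^ (2 * n + 1)) * innerSum q n := by
  have hqn := qPoch_ne_zero_of_norm_lt_one hq1.le hq1
  have hα := hasSum_pow_mul_heckeCoeff_add_delay hq0 hq1
  have hβ := hasSum_one_add_two_mul_mockPsi hq1
  have hmain := (isBaileyPair_heckeCoeff_add_delay hq0 hqn (odd_qPoch_ne_zero hq1)).tsum_eq hq1
  simp only [one_pow, one_mul] at hmain
  rw [← hβ.tsum_eq, ← hα.tsum_eq, one_div]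
  exact hmain hqn hα.summable hβ.summable

end MockTheta

theorem theorem1p3 (q : ℂ) (hq0 : q ≠ 0) (hq1 : ‖q‖ < 1) :
    -- everything in the two identities is well defined
    (Multipliable (fun i : ℕ => 1 - q ^ i * q) ∧ qPochInf q q ≠ 0 ∧
      (∀ n : ℕ, qPoch q (q ^ 2) n ≠ 0) ∧
      Summable (fun n : ℕ => psiTerm q (n + 1)) ∧
      Summable (fun n : ℕ => nuTerm (-q) n) ∧
      Summable (fun n : ℕ =>
        (-1) ^ n * q ^ (2 * n ^ 2 + n) * (1 + q ^ (2 * n + 1)) * innerSum q n) ∧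
      Summable (fun n : ℕ => (-1) ^ n * q ^ (2 * n ^ 2 + 2 * n) * innerSum q n)) ∧
    -- the two Hecke-type double sum representations
    1 + 2 * mockPsi q =
      1 / qPochInf q q *
        ∑' n : ℕ, (-1) ^ n * q ^ (2 * n ^ 2 + n) * (1 + q ^ (2 * n + 1)) * innerSum q n ∧
    mockNu (-q) =
      1 / qPochInf q q *
        ∑' n : ℕ, (-1) ^ n * q ^ (2 * n ^ 2 + 2 * n) * innerSum q n := by
  refine ⟨⟨multipliable_one_sub_pow_mul hq1 q, ?_, odd_qPoch_ne_zero hq1,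
    summable_psiTerm_succ hq1, summable_nuTerm_neg hq1, summable_hecke_psi hq0 hq1,
    summable_hecke_nu hq0 hq1⟩, one_add_two_mul_mockPsi_eq hq0 hq1, mockNu_neg_eq hq0 hq1⟩
  exact qPochInf_ne_zero hq1 (qPoch_ne_zero_of_norm_lt_one hq1.le hq1)
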